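/- Theorem. Let $n\in\{2,3\}$, let $M_n=M_n(\mathbb C)$ with matrix units $E_{ij}$, and identify $M_n\otimes M_n$ with the operators on $\mathbb C^n\otimes\mathbb C^n$. For $x\in M_n\otimes M_n$ put $$\pi(x)=\inf\Big\{\sum_{i=1}^k\|a_i\|\,\|b_i\|_1 \;:\; k\in\mathbb N,\ a_i,b_i\in M_n,\ x=\sum_{i=1}^k a_i\otimes b_i\Big\},$$ where $\|\cdot\|$ is the operator norm and $\|b\|_1=\operatorname{Tr}(b^*b)^{1/2}$ is the trace norm, and let $$\alpha(\rho)=\sup\Big\{\frac{|\operatorname{Tr}(\rho a)|}{\pi(a)} \;:\; a\in M_n\otimes M_n,\ a\neq0\Big\}$$ be the dual norm. Let $\mathfrak D$ be the set of all $\rho\in M_n\otimes M_n$ such that $\rho=\rho^*$, $\alpha(\rho)=1$, $\operatorname{Tr}\rho=n$, and $\rho$ is block-positive, i.e. $(x\otimes y,\rho\,(x\otimes y))\ge0$ for all $x,y\in\mathbb C^n$. Let $w=\sum_{i,j=1}^nE_{ij}\otimes E_{ji}$ be the Choi matrix $\sum_{i,j}E_{ij}\otimes\tau(E_{ij})$ of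 the transposition map $\tau(a)=a^{\mathrm T}$. Then every symmetry in $\mathfrak D$, i.e. every $s\in\mathfrak D$ with $s=s^*$ and $s^2=1$, is locally unitarily equivalent to $w$: there are unitary matrices $U,V\in M_n$ such that $s=(U\otimes V)\,w\,(U\otimes V)^*$. -/

import Mathlib

open scoped Matrix Kronecker ComplexOrder MatrixOrder Matrix.Norms.L2Operator

noncomputable section

namespace BlockPositive

/-- The matrix algebra `M_n(ℂ)`. -/
abbrev Mat (n : ℕ) : Type := Matrix (Fin n) (Fin n) ℂ

/-- The tensor product `M_n(ℂ) ⊗ M_n(ℂ)`, realised (through the Kronecker product `a ⊗ₖ b`) as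
the matrices with rows and columns indexed by pairs. -/
abbrev Mat₂ (n : ℕ) : Type := Matrix (Fin n × Fin n) (Fin n × Fin n) ℂ

/-- The product vector `x ⊗ y` in `ℂⁿ ⊗ ℂⁿ`. -/
def tensorVec {n : ℕ} (x y : Fin n → ℂ) : Fin n × Fin n → ℂ := fun k => x k.1 * y k.2

/-- The trace norm `‖a‖₁ = Tr |a| = Tr (a* a)^{1/2}`. The trace is a nonnegative real number, so
taking the real part only changes its type. -/
def traceNorm {n : ℕ} (a : Mat n) : ℝ := (Matrix.trace (CFC.sqrt (aᴴ * a))).re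

/-- The projective norm `π` on `M_n(ℂ) ⊗ M_n(ℂ)`: the first factor carries the operator norm, the
second factor the trace norm, and the infimum runs over all representations
`x = ∑ i, a i ⊗ b i` as finite sums. -/
def projNorm {n : ℕ} (x : Mat₂ n) : ℝ :=
  sInf {r : ℝ | ∃ (k : ℕ) (a b : Fin k → Mat n),
    x = ∑ i, a i ⊗ₖ b i ∧ r = ∑ i, ‖a i‖ * traceNorm (b i)}

/-- The norm `α` dual to the projective norm, `α(ρ) = sup_{a ≠ 0} |Tr (ρ a)| / π(a)`. -/
def alphaNorm {n : ℕ} (ρ : Mat₂ n) : ℝ :=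
  sSup {r : ℝ | ∃ a : Mat₂ n, a ≠ 0 ∧ r = ‖Matrix.trace (ρ * a)‖ / projNorm a}

/-- `ρ` is block-positive: `(x ⊗ y, ρ (x ⊗ y)) ≥ 0` for all `x, y ∈ ℂⁿ`. (For complex numbers,
`0 ≤ z` says that `z` is real and nonnegative.) -/
def IsBlockPositive {n : ℕ} (ρ : Mat₂ n) : Prop :=
  ∀ x y : Fin n → ℂ, 0 ≤ star (tensorVec x y) ⬝ᵥ (ρ *ᵥ tensorVec x y)

/-- The set `𝔇` of self-adjoint, block-positive, `α`-normalised matrices of trace `n`. -/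
def setD (n : ℕ) : Set (Mat₂ n) :=
  {ρ | ρ.IsHermitian ∧ alphaNorm ρ = 1 ∧ IsBlockPositive ρ ∧ Matrix.trace ρ = (n : ℂ)}

/-- A symmetry is a self-adjoint unitary: `s = s*` and `s² = 1`. -/
def IsSymmetry {n : ℕ} (s : Mat₂ n) : Prop := s.IsHermitian ∧ s ^ 2 = 1

/-- The Choi matrix `ρ_φ = ∑ i j, E_ij ⊗ φ(E_ij)` of a linear map `φ : M_n(ℂ) → M_n(ℂ)`. -/
def choiMatrix {n : ℕ} (φ : Mat n →ₗ[ℂ] Mat n) : Mat₂ n :=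
  ∑ i, ∑ j, Matrix.single i j (1 : ℂ) ⊗ₖ φ (Matrix.single i j (1 : ℂ))

/-- The transposition map `a ↦ aᵀ` on `M_n(ℂ)`. -/
def transposition (n : ℕ) : Mat n →ₗ[ℂ] Mat n :=
  (Matrix.transposeLinearEquiv (Fin n) (Fin n) ℂ ℂ).toLinearMap

/-- The Choi matrix of the transposition map is `∑ i j, E_ij ⊗ E_ji`. -/
theorem choiMatrix_transposition (n : ℕ) :
    choiMatrix (transposition n) =
      ∑ i, ∑ j, Matrix.single i j (1 : ℂ) ⊗ₖ Matrix.single j i (1 : ℂ) := by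
  simp [choiMatrix, transposition]

/-- `s` and `t` are locally unitarily equivalent: `s = (U ⊗ V) t (U ⊗ V)*` for some unitary
matrices `U, V ∈ M_n(ℂ)`. -/
def LocallyUnitarilyEquivalent {n : ℕ} (s t : Mat₂ n) : Prop :=
  ∃ U ∈ Matrix.unitaryGroup (Fin n) ℂ, ∃ V ∈ Matrix.unitaryGroup (Fin n) ℂ,
    s = (U ⊗ₖ V) * t * (U ⊗ₖ V)ᴴ

end BlockPositive

end

/-
Write `s` as the Choi matrix of a linear map `φ`. Block-positivity of `s` says that `φ` is
positive, and `α(s) = 1` gives `φ 1 ≤ 1`; since `Tr (φ 1) = Tr s = n`, the map `φ` is unital.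
Kadison's inequality for self-adjoint matrices then makes the sesquilinear Jordan defect
`φ(x* y + y x*) - (φ(x)* φ(y) + φ(y) φ(x)*)` nonnegative on the diagonal. The diagonal blocks of
`s² = 1` read `∑ j, φ(E_ij) φ(E_ji) = 1`; summed over the matrix units, they make the total defect
vanish, so every matrix unit has zero defect and `φ` is a Jordan `*`-homomorphism. By the same
relation the projection `p = φ(E_ii)` satisfies `∑ j ≠ i, p φ(E_ij) φ(E_ij)* p = p (1 - p) p = 0`,
hence `φ(E_ii) φ(E_ij) = 0` for `j ≠ i`, which turns `φ` into an antihomomorphism. Consequently the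
`φ(E_ji)` are matrix units, and a unitary carries the standard ones to them.
-/

namespace BlockPositive

open Matrix

theorem map_single_eq_smul_map_single_one {m R M F : Type*} [DecidableEq m] [Semiring R]
    [AddCommMonoid M] [Module R M] [FunLike F (Matrix m m R) M]
    [LinearMapClass F R (Matrix m m R) M] (f : F) (i j : m) (c : R) :
    f (single i j c) = c • f (single i j 1) := by
  rw [← map_smul, smul_single, smul_eq_mul, mul_one]

section PositiveMaps

variable {ι m B : Type*} [Fintype ι] [Fintype m] [DecidableEq m] [Ring B] [StarRing B]
  [PartialOrder B] [StarOrderedRing B] [Algebra ℂ B] [StarModule ℂ B]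

theorem star_sum_smul_mul_sum_smul_le {G : ι → B} (hG : ∀ k, 0 ≤ G k) (hG1 : ∑ k, G k = 1)
    (c : ι → ℂ) :
    star (∑ k, c k • G k) * ∑ k, c k • G k ≤ ∑ k, (star (c k) * c k) • G k := by
  set Y := ∑ k, c k • G k with hY
  have hstarY : ∑ k, star (c k) • G k = star Y := by
    simp only [hY, star_sum, star_smul, (IsSelfAdjoint.of_nonneg (hG _)).star_eq]
  have key : ∑ k, (star (c k) * c k) • G k - star Y * Y =
      ∑ k, star (c k • 1 - Y) * G k * (c k • 1 - Y) := by
    have hterm (k : ι) : star (c k • 1 - Y) * G k * (c k • 1 - Y) =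
        (star (c k) * c k) • G k - (star (c k) • G k) * Y - star Y * (c k • G k)
          + star Y * G k * Y := by
      simp only [star_sub, star_smul, star_one, sub_mul, mul_sub, smul_mul_assoc, mul_smul_comm,
        one_mul, mul_one]
      module
    simp only [hterm, Finset.sum_add_distrib, Finset.sum_sub_distrib, ← Finset.sum_mul,
      ← Finset.mul_sum, hstarY, hG1, ← hY]
    noncomm_ring
  rw [← sub_nonneg, key]
  exact Finset.sum_nonneg fun k _ => star_left_conjugate_nonneg (hG k) _

theorem exists_spectral_resolution {a : Matrix m m ℂ} (ha : a.IsHermitian) :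
    ∃ (l : m → ℝ) (P : m → Matrix m m ℂ), (∀ k, 0 ≤ P k) ∧ ∑ k, P k = 1 ∧
      a = ∑ k, (l k : ℂ) • P k ∧ a * a = ∑ k, ((l k : ℂ) * l k) • P k := by
  set ψ := Unitary.conjStarAlgAut ℂ (Matrix m m ℂ) ha.eigenvectorUnitary
  have hψ (d : m → ℂ) : ψ (diagonal d) = ∑ k, d k • ψ (single k k 1) := by
    rw [← sum_single_eq_diagonal, map_sum]
    exact Finset.sum_congr rfl fun k _ => map_single_eq_smul_map_single_one ψ k k (d k)
  have haψ : a = ψ (diagonal fun k => (ha.eigenvalues k : ℂ)) := ha.spectral_theorem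
  refine ⟨ha.eigenvalues, fun k => ψ (single k k 1), fun k => ?_, ?_, ?_, ?_⟩
  · have hsingle : single k k (1 : ℂ) = star (single k k 1) * single k k 1 := by
      simp [star_eq_conjTranspose]
    beta_reduce
    rw [hsingle, map_mul, map_star]
    exact star_mul_self_nonneg _
  · simpa using (hψ 1).symm
  · exact haψ.trans (hψ _)
  · conv_lhs => rw [haψ, ← map_mul, diagonal_mul_diagonal]
    exact hψ _

theorem map_mul_map_le_map_mul_self (φ : Matrix m m ℂ →ₚ[ℂ] B) (h1 : φ 1 = 1)
    {a : Matrix m m ℂ} (ha : a.IsHermitian) : φ a * φ a ≤ φ (a * a) := by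
  obtain ⟨l, P, hP, hP1, haP, haaP⟩ := exists_spectral_resolution ha
  have hφa : φ a = ∑ k, (l k : ℂ) • φ (P k) := by rw [haP, map_sum]; simp only [map_smul]
  have hφaa : φ (a * a) = ∑ k, (star (l k : ℂ) * l k) • φ (P k) := by
    rw [haaP, map_sum]; simp
  have hsa : star (φ a) = φ a := by rw [← map_star]; exact congrArg φ ha
  have h := star_sum_smul_mul_sum_smul_le (G := fun k => φ (P k)) (fun k => map_nonneg φ (hP k))
    (by rw [← map_sum, hP1, h1]) (fun k => (l k : ℂ))
  rwa [← hφa, ← hφaa, hsa] at h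

end PositiveMaps

section Sesquilinear

variable {E F : Type*} [AddCommGroup E] [Module ℂ E] [AddCommGroup F] [Module ℂ F]

theorem eq_zero_of_isAlt {D : E →ₗ⋆[ℂ] E →ₗ[ℂ] F} (hD : D.IsAlt) : D = 0 := by
  have : IsAddTorsionFree F := .of_isTorsionFree ℂ F
  ext x y
  have h : -D (Complex.I • x) y = D y (Complex.I • x) := hD.neg _ _
  rw [LinearMap.map_smulₛₗ, LinearMap.smul_apply, Complex.conj_I, neg_smul, neg_neg, map_smul,
    ← hD.neg x y, smul_neg, self_eq_neg, smul_eq_zero] at h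
  exact h.resolve_left Complex.I_ne_zero

theorem eq_zero_of_nonneg_of_span_eq_top [PartialOrder F] [IsOrderedAddMonoid F]
    {D : E →ₗ⋆[ℂ] E →ₗ[ℂ] F} (hD : ∀ x, 0 ≤ D x x) {S : Set E} (hS : Submodule.span ℂ S = ⊤)
    (h0 : ∀ x ∈ S, D x x = 0) : D = 0 := by
  refine eq_zero_of_isAlt fun x => ?_
  induction (hS ▸ Submodule.mem_top : x ∈ Submodule.span ℂ S) using Submodule.span_induction with
  | mem x hx => exact h0 x hx
  | zero => simp
  | smul c x _ hx => simp [hx]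
  | add x y _ _ hx hy =>
    have parallelogram : D (x + y) (x + y) + D (x - y) (x - y) = 2 • D x x + 2 • D y y := by
      simp only [map_add, map_sub, LinearMap.add_apply, LinearMap.sub_apply]
      abel
    rw [hx, hy, smul_zero, add_zero] at parallelogram
    exact ((add_eq_zero_iff_of_nonneg (hD _) (hD _)).1 parallelogram).1

end Sesquilinear

section JordanDefect

variable {A B : Type*} [Ring A] [StarRing A] [Algebra ℂ A] [StarModule ℂ A]
  [Ring B] [StarRing B] [Algebra ℂ B] [StarModule ℂ B]

/-- A Jordan `*`-homomorphism: a linear map preserving the involution and the symmetrised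
product. -/
structure IsJordanStarHom (φ : A →ₗ[ℂ] B) : Prop where
  map_star : ∀ x, φ (star x) = star (φ x)
  map_mul_add_mul : ∀ x y, φ (x * y + y * x) = φ x * φ y + φ y * φ x

/-- The defect of the Jordan identity for `φ`, as a sesquilinear map. The first variable enters
through its adjoint, so that for a unital positive `φ` the diagonal values are positive. -/
def jordanDefect (φ : A →ₗ[ℂ] B) : A →ₗ⋆[ℂ] A →ₗ[ℂ] B :=
  LinearMap.mk₂'ₛₗ (starRingEnd ℂ) (RingHom.id ℂ)
    (fun x y => φ (star x * y + y * star x) - (star (φ x) * φ y + φ y * star (φ x)))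
    (fun x x' y => by simp only [star_add, add_mul, mul_add, map_add]; abel)
    (fun c x y => by
      simp only [star_smul, smul_mul_assoc, mul_smul_comm, map_add, map_smul, smul_sub, smul_add,
        starRingEnd_apply])
    (fun x y y' => by simp only [add_mul, mul_add, map_add]; abel)
    (fun c x y => by
      simp only [smul_mul_assoc, mul_smul_comm, map_add, map_smul, smul_sub, smul_add,
        RingHom.id_apply])

theorem jordanDefect_apply (φ : A →ₗ[ℂ] B) (x y : A) :
    jordanDefect φ x y = φ (star x * y + y * star x) - (star (φ x) * φ y + φ y * star (φ x)) :=
  rfl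

theorem IsJordanStarHom.of_jordanDefect_eq_zero {φ : A →ₗ[ℂ] B}
    (hstar : ∀ x, φ (star x) = star (φ x)) (h : jordanDefect φ = 0) : IsJordanStarHom φ where
  map_star := hstar
  map_mul_add_mul x y := by
    have := congr($h (star x) y)
    rwa [jordanDefect_apply, hstar, star_star, star_star, LinearMap.zero_apply,
      LinearMap.zero_apply, sub_eq_zero] at this

end JordanDefect

section UnitalPositiveMaps

variable {m B : Type*} [Fintype m] [DecidableEq m] [Ring B] [StarRing B]
  [PartialOrder B] [StarOrderedRing B] [Algebra ℂ B] [StarModule ℂ B]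

open ComplexStarModule in
theorem jordanDefect_self_nonneg (φ : Matrix m m ℂ →ₚ[ℂ] B) (h1 : φ 1 = 1) (x : Matrix m m ℂ) :
    0 ≤ jordanDefect φ.toLinearMap x x := by
  have hre := map_mul_map_le_map_mul_self φ h1 (ℜ x).2
  have him := map_mul_map_le_map_mul_self φ h1 (ℑ x).2
  rw [jordanDefect_apply, star_mul_self_add_self_mul_star, star_mul_self_add_self_mul_star,
    sub_nonneg, map_nsmul, map_add, PositiveLinearMap.coe_toLinearMap, ← map_realPart,
    ← map_imaginaryPart]
  exact nsmul_le_nsmul_right (add_le_add hre him) 2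

theorem sum_jordanDefect_single {φ : Matrix m m ℂ →ₚ[ℂ] B} (h1 : φ 1 = 1)
    (hrow : ∀ i, ∑ j, φ (single i j 1) * φ (single j i 1) = 1) :
    ∑ i, ∑ j, jordanDefect φ.toLinearMap (single i j 1) (single i j 1) = 0 := by
  have hdiag : ∑ i, φ (single i i 1) = 1 := by
    rw [← map_sum, sum_single_eq_diagonal, diagonal_one, h1]
  have hterm (i j : m) : jordanDefect φ.toLinearMap (single i j 1) (single i j 1) =
      φ (single j j 1) + φ (single i i 1) - (φ (single j i 1) * φ (single i j 1) +
        φ (single i j 1) * φ (single j i 1)) := by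
    simp [jordanDefect_apply, ← map_star, star_eq_conjTranspose]
  simp only [hterm, Finset.sum_sub_distrib, Finset.sum_add_distrib, hrow, hdiag]
  rw [Finset.sum_comm (f := fun i j => φ (single j i 1) * φ (single i j 1))]
  simp only [hrow, Finset.sum_const, ← Finset.smul_sum, hdiag, sub_self]

theorem isJordanStarHom_of_sum_mul_eq_one {φ : Matrix m m ℂ →ₚ[ℂ] B} (h1 : φ 1 = 1)
    (hrow : ∀ i, ∑ j, φ (single i j 1) * φ (single j i 1) = 1) :
    IsJordanStarHom φ.toLinearMap := by
  have hpos := jordanDefect_self_nonneg φ h1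
  have hsingle (i j : m) : jordanDefect φ.toLinearMap (single i j 1) (single i j 1) = 0 := by
    have h := sum_jordanDefect_single h1 hrow
    rw [Finset.sum_eq_zero_iff_of_nonneg fun i _ => Finset.sum_nonneg fun j _ => hpos _] at h
    exact (Finset.sum_eq_zero_iff_of_nonneg fun j _ => hpos _).1 (h i (Finset.mem_univ i)) j
      (Finset.mem_univ j)
  refine .of_jordanDefect_eq_zero (map_star φ)
    (eq_zero_of_nonneg_of_span_eq_top hpos (stdBasis ℂ m m).span_eq ?_)
  rintro _ ⟨⟨i, j⟩, rfl⟩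
  rw [stdBasis_eq_single]
  exact hsingle i j

end UnitalPositiveMaps

namespace IsJordanStarHom

section Idempotents

variable {A B : Type*} [Ring A] [StarRing A] [Algebra ℂ A] [Ring B] [StarRing B] [Algebra ℂ B]
  {φ : A →ₗ[ℂ] B}

theorem isIdempotentElem_map (hφ : IsJordanStarHom φ) {p : A} (hp : IsIdempotentElem p) :
    IsIdempotentElem (φ p) := by
  have : IsAddTorsionFree B := .of_isTorsionFree ℂ B
  have h := hφ.map_mul_add_mul p p
  rw [hp.eq, map_add, ← two_nsmul, ← two_nsmul] at h
  exact (nsmul_right_injective two_ne_zero h).symm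

theorem map_mul_map_eq_zero (hφ : IsJordanStarHom φ) {p x : A} (hp : IsIdempotentElem p)
    (hpx : p * x = 0) (hxp : x * p = 0) : φ p * φ x = 0 := by
  have : IsAddTorsionFree B := .of_isTorsionFree ℂ B
  refine (hφ.isIdempotentElem_map hp).mul_eq_zero_of_anticommute ?_
  rw [← hφ.map_mul_add_mul, hpx, hxp, add_zero, map_zero]

end Idempotents

section MatrixUnits

variable {m B : Type*} [Fintype m] [DecidableEq m]

theorem star_map_single [Ring B] [StarRing B] [Algebra ℂ B] {φ : Matrix m m ℂ →ₗ[ℂ] B}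
    (hφ : IsJordanStarHom φ) (i j : m) : star (φ (single i j 1)) = φ (single j i 1) := by
  rw [← hφ.map_star, star_eq_conjTranspose, conjTranspose_single, star_one]

theorem isIdempotentElem_map_single_self [Ring B] [StarRing B] [Algebra ℂ B]
    {φ : Matrix m m ℂ →ₗ[ℂ] B} (hφ : IsJordanStarHom φ) (i : m) :
    IsIdempotentElem (φ (single i i 1)) :=
  hφ.isIdempotentElem_map (by simp [IsIdempotentElem])

theorem map_single_self_mul_map_single_self_of_ne [Ring B] [StarRing B] [Algebra ℂ B]
    {φ : Matrix m m ℂ →ₗ[ℂ] B} (hφ : IsJordanStarHom φ) {i j : m} (hij : i ≠ j) :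
    φ (single i i 1) * φ (single j j 1) = 0 :=
  hφ.map_mul_map_eq_zero (by simp [IsIdempotentElem]) (by simp [hij]) (by simp [hij.symm])

variable [CStarAlgebra B] [PartialOrder B] [StarOrderedRing B]
  {φ : Matrix m m ℂ →ₗ[ℂ] B}

theorem map_single_self_mul_map_single_eq_zero (hφ : IsJordanStarHom φ)
    (hrow : ∀ i, ∑ j, φ (single i j 1) * φ (single j i 1) = 1) {i j : m} (hij : i ≠ j) :
    φ (single i i 1) * φ (single i j 1) = 0 := by
  set p := φ (single i i 1)
  have hp : p * p = p := hφ.isIdempotentElem_map_single_self i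
  have hoff : ∑ k ∈ Finset.univ.erase i, φ (single i k 1) * φ (single k i 1) = 1 - p := by
    rw [← hrow i, ← Finset.add_sum_erase _ _ (Finset.mem_univ i), hp, add_sub_cancel_left]
  have hsum :
      ∑ k ∈ Finset.univ.erase i, p * φ (single i k 1) * star (p * φ (single i k 1)) = 0 := by
    calc ∑ k ∈ Finset.univ.erase i, p * φ (single i k 1) * star (p * φ (single i k 1))
        = p * (∑ k ∈ Finset.univ.erase i, φ (single i k 1) * φ (single k i 1)) * p := by
          simp only [Finset.mul_sum, Finset.sum_mul, star_mul, hφ.star_map_single, p, mul_assoc]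
      _ = 0 := by rw [hoff, mul_sub, mul_one, hp, sub_self, zero_mul]
  rw [Finset.sum_eq_zero_iff_of_nonneg fun k _ => mul_star_self_nonneg _] at hsum
  exact CStarRing.mul_star_self_eq_zero_iff _ |>.1
    (hsum j (Finset.mem_erase.2 ⟨hij.symm, Finset.mem_univ j⟩))

theorem map_single_mul_map_single_self (hφ : IsJordanStarHom φ)
    (hrow : ∀ i, ∑ j, φ (single i j 1) * φ (single j i 1) = 1) (i j : m) :
    φ (single i j 1) * φ (single i i 1) = φ (single i j 1) := by
  obtain rfl | hij := eq_or_ne i j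
  · exact hφ.isIdempotentElem_map_single_self i
  · have h := hφ.map_mul_add_mul (single i i 1) (single i j 1)
    rw [hφ.map_single_self_mul_map_single_eq_zero hrow hij, zero_add] at h
    simpa [hij.symm] using h.symm

theorem map_single_self_mul_map_single (hφ : IsJordanStarHom φ)
    (hrow : ∀ i, ∑ j, φ (single i j 1) * φ (single j i 1) = 1) (i j : m) :
    φ (single j j 1) * φ (single i j 1) = φ (single i j 1) := by
  have h := congrArg star (hφ.map_single_mul_map_single_self hrow j i)
  rwa [star_mul, hφ.star_map_single, hφ.star_map_single] at h

theorem map_single_mul_map_single_of_ne (hφ : IsJordanStarHom φ)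
    (hrow : ∀ i, ∑ j, φ (single i j 1) * φ (single j i 1) = 1) {i l : m} (hil : i ≠ l) (j k : m) :
    φ (single i j 1) * φ (single k l 1) = 0 := by
  calc φ (single i j 1) * φ (single k l 1)
      = φ (single i j 1) * (φ (single i i 1) * φ (single l l 1)) * φ (single k l 1) := by
        rw [← mul_assoc, hφ.map_single_mul_map_single_self hrow, mul_assoc,
          hφ.map_single_self_mul_map_single hrow]
    _ = 0 := by rw [hφ.map_single_self_mul_map_single_self_of_ne hil, mul_zero, zero_mul]

theorem map_single_mul_map_single_same (hφ : IsJordanStarHom φ)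
    (hrow : ∀ i, ∑ j, φ (single i j 1) * φ (single j i 1) = 1) (i j k : m) :
    φ (single i j 1) * φ (single k i 1) = φ (single k j 1) := by
  have h := hφ.map_mul_add_mul (single i j 1) (single k i 1)
  obtain rfl | hjk := eq_or_ne j k
  · obtain rfl | hij := eq_or_ne i j
    · exact hφ.isIdempotentElem_map_single_self i
    · have h' := congrArg (φ (single j j 1) * ·) h
      simpa [mul_add, ← mul_assoc, hφ.map_single_self_mul_map_single hrow,
        hφ.map_single_self_mul_map_single_eq_zero hrow hij.symm,
        hφ.map_single_self_mul_map_single_self_of_ne hij.symm] using h'.symm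
  · rw [hφ.map_single_mul_map_single_of_ne hrow hjk.symm, add_zero] at h
    simpa [hjk] using h.symm

end MatrixUnits

end IsJordanStarHom

theorem exists_mulVec_eq_self_of_isIdempotentElem {m 𝕜 : Type*} [Fintype m] [RCLike 𝕜]
    {p : Matrix m m 𝕜} (hp : IsIdempotentElem p) (h0 : p ≠ 0) :
    ∃ v : m → 𝕜, p *ᵥ v = v ∧ star v ⬝ᵥ v = 1 := by
  classical
  obtain ⟨w, hw⟩ : ∃ w, p *ᵥ w ≠ 0 := by
    by_contra! h
    exact h0 (Matrix.ext_of_mulVec_single fun i => by rw [h, zero_mulVec])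
  set u := WithLp.toLp 2 (p *ᵥ w)
  have hu : u ≠ 0 := by simpa [u] using hw
  refine ⟨(‖u‖⁻¹ : 𝕜) • (p *ᵥ w), by rw [mulVec_smul, mulVec_mulVec, hp.eq], ?_⟩
  calc star ((‖u‖⁻¹ : 𝕜) • (p *ᵥ w)) ⬝ᵥ ((‖u‖⁻¹ : 𝕜) • (p *ᵥ w))
      = inner 𝕜 ((‖u‖⁻¹ : 𝕜) • u) ((‖u‖⁻¹ : 𝕜) • u) := by
        rw [EuclideanSpace.inner_eq_star_dotProduct, dotProduct_comm]; rfl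
    _ = 1 := by rw [inner_self_eq_norm_sq_to_K, norm_smul_inv_norm hu]; simp

section MatrixUnits

variable {m 𝕜 : Type*} [Fintype m] [DecidableEq m] [RCLike 𝕜]

/-- A system of matrix units in a unital `*`-ring. -/
structure IsMatrixUnits {R : Type*} [Ring R] [StarRing R] (e : m → m → R) : Prop where
  star_apply : ∀ i j, star (e i j) = e j i
  mul_apply : ∀ i j k l, e i j * e k l = if j = k then e i l else 0
  sum_diag : ∑ i, e i i = 1

theorem IsJordanStarHom.isMatrixUnits_swap {B : Type*} [CStarAlgebra B] [PartialOrder B]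
    [StarOrderedRing B] {φ : Matrix m m ℂ →ₗ[ℂ] B} (hφ : IsJordanStarHom φ) (h1 : φ 1 = 1)
    (hrow : ∀ i, ∑ j, φ (single i j 1) * φ (single j i 1) = 1) :
    IsMatrixUnits fun i j => φ (single j i 1) where
  star_apply i j := hφ.star_map_single j i
  mul_apply i j k l := by
    split_ifs with hjk
    · rw [hjk, hφ.map_single_mul_map_single_same hrow]
    · exact hφ.map_single_mul_map_single_of_ne hrow hjk i l
  sum_diag := by rw [← map_sum, sum_single_eq_diagonal, diagonal_one, h1]

theorem IsMatrixUnits.apply_ne_zero {R : Type*} [Ring R] [StarRing R] [Nontrivial R] {e : m → m → R}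
    (he : IsMatrixUnits e) (i j : m) : e i j ≠ 0 := by
  intro h0
  have hdiag (k : m) : e k k = 0 := by
    calc e k k = e k i * e i j * e j k := by simp [he.mul_apply]
      _ = 0 := by rw [h0, mul_zero, zero_mul]
  exact one_ne_zero (by rw [← he.sum_diag]; exact Finset.sum_eq_zero fun k _ => hdiag k)

theorem IsMatrixUnits.exists_unitary {e : m → m → Matrix m m 𝕜} (he : IsMatrixUnits e) :
    ∃ V ∈ unitaryGroup m 𝕜, ∀ i j, e i j = V * single i j 1 * Vᴴ := by
  obtain _ | _ := isEmpty_or_nonempty m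
  · exact ⟨1, one_mem _, isEmptyElim⟩
  let o := Classical.arbitrary m
  obtain ⟨v, hv, hvv⟩ := exists_mulVec_eq_self_of_isIdempotentElem
    (p := e o o) (by simp [IsIdempotentElem, he.mul_apply]) (he.apply_ne_zero o o)
  let V : Matrix m m 𝕜 := .of fun a k => (e k o *ᵥ v) a
  have horth : Vᴴ * V = 1 := by
    ext i j
    calc (Vᴴ * V) i j = star (e i o *ᵥ v) ⬝ᵥ (e j o *ᵥ v) := rfl
      _ = star v ⬝ᵥ ((e o i * e j o) *ᵥ v) := by
        rw [star_mulVec, ← star_eq_conjTranspose, he.star_apply, ← dotProduct_mulVec, mulVec_mulVec]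
      _ = (1 : Matrix m m 𝕜) i j := by
        rw [he.mul_apply, one_apply]
        split_ifs
        · rw [hv, hvv]
        · rw [zero_mulVec, dotProduct_zero]
  have hunit : V * Vᴴ = 1 := mul_eq_one_comm.1 horth
  have hintertwine (i j : m) : e i j * V = V * single i j 1 := by
    ext a k
    calc (e i j * V) a k = (e i j *ᵥ (e k o *ᵥ v)) a := rfl
      _ = (V * (single i j 1 : Matrix m m 𝕜)) a k := by
        rw [mulVec_mulVec, he.mul_apply]
        obtain rfl | hjk := eq_or_ne j k
        · simp [V]
        · simp [hjk, hjk.symm]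
  refine ⟨V, mem_unitaryGroup_iff.2 hunit, fun i j => ?_⟩
  rw [← hintertwine, mul_assoc, hunit, mul_one]

end MatrixUnits

theorem exists_unitary_eq_conj_transpose {m : Type*} [Fintype m] [DecidableEq m]
    {φ : Matrix m m ℂ →ₚ[ℂ] Matrix m m ℂ} (h1 : φ 1 = 1)
    (hrow : ∀ i, ∑ j, φ (single i j 1) * φ (single j i 1) = 1) :
    ∃ V ∈ unitaryGroup m ℂ, ∀ x, φ x = V * xᵀ * Vᴴ := by
  obtain ⟨V, hV, hunits⟩ :=
    ((isJordanStarHom_of_sum_mul_eq_one h1 hrow).isMatrixUnits_swap h1 hrow).exists_unitary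
  refine ⟨V, hV, fun x => ?_⟩
  induction x using Matrix.induction_on' with
  | h_zero => simp
  | h_add x y hx hy => rw [map_add, hx, hy, transpose_add, mul_add, add_mul]
  | h_std_basis i j c =>
    have h : φ (single i j 1) = V * single j i 1 * Vᴴ := hunits j i
    have hsmul : single j i c = c • single j i 1 := by rw [smul_single, smul_eq_mul, mul_one]
    rw [map_single_eq_smul_map_single_one φ, h, transpose_single, hsmul, mul_smul_comm,
      smul_mul_assoc]

section Choi

variable {n : ℕ} {φ : Mat n →ₗ[ℂ] Mat n}

theorem choiMatrix_eq_comp (φ : Mat n →ₗ[ℂ] Mat n) :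
    choiMatrix φ = comp _ _ _ _ ℂ (of fun i j => φ (single i j 1)) := by
  ext ⟨i, k⟩ ⟨j, l⟩
  simp only [choiMatrix, Matrix.sum_apply, kroneckerMap_apply, single_apply, comp_apply, of_apply]
  rw [Finset.sum_eq_single i, Finset.sum_eq_single j] <;> simp +contextual

theorem choiMatrix_surjective : Function.Surjective (choiMatrix (n := n)) := by
  intro s
  refine ⟨(stdBasis ℂ (Fin n) (Fin n)).constr ℂ fun p => (comp _ _ _ _ ℂ).symm s p.1 p.2, ?_⟩
  rw [choiMatrix_eq_comp, ← Equiv.eq_symm_apply]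
  ext i j : 2
  rw [of_apply, ← stdBasis_eq_single, Module.Basis.constr_basis]

theorem trace_choiMatrix_mul_kronecker (φ : Mat n →ₗ[ℂ] Mat n) (a b : Mat n) :
    trace (choiMatrix φ * (a ⊗ₖ b)) = trace (φ aᵀ * b) := by
  calc trace (choiMatrix φ * (a ⊗ₖ b))
      = ∑ i, ∑ j, a j i * trace (φ (single i j 1) * b) := by
        simp only [choiMatrix, Finset.sum_mul, ← mul_kronecker_mul, trace_sum, trace_kronecker,
          trace_single_mul, one_smul]
    _ = trace (φ aᵀ * b) := by
        conv_rhs => rw [matrix_eq_sum_single aᵀ]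
        simp only [map_sum, Finset.sum_mul, trace_sum]
        refine Finset.sum_congr rfl fun i _ => Finset.sum_congr rfl fun j _ => ?_
        rw [map_single_eq_smul_map_single_one φ i j (aᵀ i j), smul_mul_assoc, trace_smul,
          smul_eq_mul, transpose_apply]

theorem trace_choiMatrix (φ : Mat n →ₗ[ℂ] Mat n) : trace (choiMatrix φ) = trace (φ 1) := by
  simpa using trace_choiMatrix_mul_kronecker φ 1 1

theorem sum_map_single_mul_map_single (hφ : choiMatrix φ ^ 2 = 1) (i : Fin n) :
    ∑ j, φ (single i j 1) * φ (single j i 1) = 1 := by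
  have h : (of fun i j => φ (single i j 1)) ^ 2 = 1 :=
    (compRingEquiv (Fin n) (Fin n) ℂ).injective (by
      rw [map_pow, map_one, ← hφ, choiMatrix_eq_comp]; rfl)
  rw [pow_two] at h
  simpa [mul_apply] using congr($h i i)

theorem vecMulVec_tensorVec (x y : Fin n → ℂ) :
    vecMulVec (tensorVec x y) (star (tensorVec x y)) =
      vecMulVec x (star x) ⊗ₖ vecMulVec y (star y) := by
  ext p q
  simp only [vecMulVec_apply, kroneckerMap_apply, tensorVec, Pi.star_apply, star_mul']
  ring

theorem trace_mul_vecMulVec {m n R : Type*} [Fintype m] [Fintype n] [CommSemiring R]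
    (a : Matrix m n R) (x : n → R) (y : m → R) :
    trace (a * vecMulVec x y) = y ⬝ᵥ (a *ᵥ x) := by
  rw [mul_vecMulVec, trace_vecMulVec, dotProduct_comm]

theorem posSemidef_of_dotProduct_mulVec_nonneg {m : Type*} [Fintype m] {a : Matrix m m ℂ}
    (ha : ∀ x, 0 ≤ star x ⬝ᵥ (a *ᵥ x)) : a.PosSemidef := by
  classical
  rw [← isPositive_toEuclideanLin_iff, LinearMap.isPositive_iff_complex]
  intro x
  have hinner : 0 ≤ inner ℂ (a.toEuclideanLin x) x := by
    have hx : inner ℂ x (a.toEuclideanLin x) = star x.ofLp ⬝ᵥ (a *ᵥ x.ofLp) := by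
      rw [EuclideanSpace.inner_eq_star_dotProduct, dotProduct_comm]; rfl
    rw [← inner_conj_symm, hx]
    exact star_nonneg_iff.2 (ha _)
  obtain ⟨r, hr, hinner⟩ := RCLike.nonneg_iff_exists_ofReal.1 hinner
  rw [← hinner]
  exact ⟨by simp, by simpa using hr⟩

theorem IsBlockPositive.map_nonneg (hφ : IsBlockPositive (choiMatrix φ)) {x : Mat n}
    (hx : 0 ≤ x) : 0 ≤ φ x := by
  obtain ⟨k, v, rfl⟩ := posSemidef_iff_eq_sum_vecMulVec.1 (nonneg_iff_posSemidef.1 hx)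
  rw [map_sum]
  refine Finset.sum_nonneg fun i _ => nonneg_iff_posSemidef.2 ?_
  refine posSemidef_of_dotProduct_mulVec_nonneg fun y => ?_
  have h := hφ (star (v i)) y
  rw [← trace_mul_vecMulVec, vecMulVec_tensorVec, trace_choiMatrix_mul_kronecker,
    trace_mul_vecMulVec, transpose_vecMulVec, star_star] at h
  exact h

end Choi

section Norms

theorem norm_apply_le_l2_opNorm {m n 𝕜 : Type*} [Fintype m] [Fintype n] [DecidableEq n] [RCLike 𝕜]
    (a : Matrix m n 𝕜) (i : m) (j : n) : ‖a i j‖ ≤ ‖a‖ := by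
  calc ‖a i j‖ = ‖(WithLp.toLp 2 (a *ᵥ Pi.single j 1) : EuclideanSpace 𝕜 m) i‖ := by simp
    _ ≤ ‖(WithLp.toLp 2 (a *ᵥ Pi.single j 1) : EuclideanSpace 𝕜 m)‖ := PiLp.norm_apply_le _ i
    _ ≤ ‖a‖ * ‖EuclideanSpace.single j (1 : 𝕜)‖ := l2_opNorm_mulVec a (EuclideanSpace.single j 1)
    _ = ‖a‖ := by rw [PiLp.norm_single, norm_one, mul_one]

theorem l2_opNorm_one_le {m 𝕜 : Type*} [Fintype m] [DecidableEq m] [RCLike 𝕜] :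
    ‖(1 : Matrix m m 𝕜)‖ ≤ 1 := by
  rw [← diagonal_one, l2_opNorm_diagonal]
  exact (pi_norm_le_iff_of_nonneg zero_le_one).2 fun _ => norm_one.le

theorem l2_opNorm_le_re_trace {m 𝕜 : Type*} [Fintype m] [DecidableEq m] [RCLike 𝕜]
    {a : Matrix m m 𝕜} (ha : a.PosSemidef) : ‖a‖ ≤ RCLike.re (trace a) := by
  have hnonneg := ha.eigenvalues_nonneg
  calc ‖a‖ = ‖(RCLike.ofReal ∘ ha.1.eigenvalues : m → 𝕜)‖ := by
        conv_lhs => rw [ha.1.spectral_theorem, Unitary.conjStarAlgAut_apply, ← Unitary.coe_star,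
          CStarRing.norm_mul_coe_unitary, CStarRing.norm_coe_unitary_mul, l2_opNorm_diagonal]
    _ ≤ ∑ i, ha.1.eigenvalues i := by
        refine (pi_norm_le_iff_of_nonneg (Finset.sum_nonneg fun i _ => hnonneg i)).2 fun i => ?_
        rw [Function.comp_apply, RCLike.norm_of_nonneg (hnonneg i)]
        exact Finset.single_le_sum (fun i _ => hnonneg i) (Finset.mem_univ i)
    _ = RCLike.re (trace a) := by rw [ha.1.trace_eq_sum_eigenvalues]; simp

variable {n : ℕ}

theorem traceNorm_eq_re_trace_abs (b : Mat n) : traceNorm b = (trace (CFC.abs b)).re := rfl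

theorem traceNorm_of_nonneg {b : Mat n} (hb : 0 ≤ b) : traceNorm b = (trace b).re := by
  rw [traceNorm_eq_re_trace_abs, CFC.abs_of_nonneg b hb]

theorem norm_le_traceNorm (b : Mat n) : ‖b‖ ≤ traceNorm b := by
  rw [← CFC.norm_abs]
  exact l2_opNorm_le_re_trace (nonneg_iff_posSemidef.1 (CFC.abs_nonneg b))

theorem traceNorm_nonneg (b : Mat n) : 0 ≤ traceNorm b :=
  (norm_nonneg b).trans (norm_le_traceNorm b)

theorem projNorm_kronecker_le (a b : Mat n) : projNorm (a ⊗ₖ b) ≤ ‖a‖ * traceNorm b := by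
  refine csInf_le ⟨0, ?_⟩ ⟨1, fun _ => a, fun _ => b, by simp, by simp⟩
  rintro r ⟨k, a, b, -, rfl⟩
  exact Finset.sum_nonneg fun i _ => mul_nonneg (norm_nonneg _) (traceNorm_nonneg _)

theorem exists_eq_sum_kronecker (x : Mat₂ n) :
    ∃ (k : ℕ) (a b : Fin k → Mat n), x = ∑ i, a i ⊗ₖ b i := by
  obtain ⟨φ, rfl⟩ := choiMatrix_surjective x
  let e := (Fintype.equivFin (Fin n × Fin n)).symm
  refine ⟨_, fun t => single (e t).1 (e t).2 1, fun t => φ (single (e t).1 (e t).2 1), ?_⟩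
  rw [choiMatrix, ← Fintype.sum_prod_type',
    e.sum_comp fun p => single p.1 p.2 1 ⊗ₖ φ (single p.1 p.2 1)]

theorem norm_apply_le_projNorm (x : Mat₂ n) (p q : Fin n × Fin n) : ‖x p q‖ ≤ projNorm x := by
  obtain ⟨k, a, b, hx⟩ := exists_eq_sum_kronecker x
  refine le_csInf ⟨_, k, a, b, hx, rfl⟩ ?_
  rintro r ⟨k, a, b, rfl, rfl⟩
  rw [Matrix.sum_apply]
  refine (norm_sum_le _ _).trans (Finset.sum_le_sum fun i _ => ?_)
  rw [kroneckerMap_apply, norm_mul]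
  exact mul_le_mul (norm_apply_le_l2_opNorm _ _ _)
    ((norm_apply_le_l2_opNorm _ _ _).trans (norm_le_traceNorm _)) (norm_nonneg _) (norm_nonneg _)

theorem projNorm_nonneg (x : Mat₂ n) : 0 ≤ projNorm x := by
  refine Real.sInf_nonneg ?_
  rintro r ⟨k, a, b, -, rfl⟩
  exact Finset.sum_nonneg fun i _ => mul_nonneg (norm_nonneg _) (traceNorm_nonneg _)

theorem alphaNorm_nonneg (ρ : Mat₂ n) : 0 ≤ alphaNorm ρ := by
  refine Real.sSup_nonneg ?_
  rintro r ⟨a, -, rfl⟩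
  exact div_nonneg (norm_nonneg _) (projNorm_nonneg a)

theorem norm_trace_mul_le_sum_norm_mul_projNorm (ρ x : Mat₂ n) :
    ‖trace (ρ * x)‖ ≤ (∑ p, ∑ q, ‖ρ p q‖) * projNorm x := by
  simp only [trace, diag_apply, mul_apply, Finset.sum_mul]
  refine (norm_sum_le _ _).trans (Finset.sum_le_sum fun p _ => ?_)
  refine (norm_sum_le _ _).trans (Finset.sum_le_sum fun q _ => ?_)
  rw [norm_mul]
  exact mul_le_mul_of_nonneg_left (norm_apply_le_projNorm x q p) (norm_nonneg _)

theorem norm_trace_mul_le (ρ x : Mat₂ n) : ‖trace (ρ * x)‖ ≤ alphaNorm ρ * projNorm x := by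
  obtain rfl | hx := eq_or_ne x 0
  · rw [mul_zero, trace_zero, norm_zero]
    exact mul_nonneg (alphaNorm_nonneg ρ) (projNorm_nonneg 0)
  have hbdd : BddAbove {r : ℝ | ∃ a : Mat₂ n, a ≠ 0 ∧ r = ‖trace (ρ * a)‖ / projNorm a} := by
    refine ⟨∑ p, ∑ q, ‖ρ p q‖, ?_⟩
    rintro r ⟨a, -, rfl⟩
    exact div_le_of_le_mul₀ (projNorm_nonneg a)
      (Finset.sum_nonneg fun _ _ => Finset.sum_nonneg fun _ _ => norm_nonneg _)
      (norm_trace_mul_le_sum_norm_mul_projNorm ρ a)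
  have hpos : 0 < projNorm x := by
    obtain ⟨p, q, hpq⟩ : ∃ p q, x p q ≠ 0 := by
      by_contra! h
      exact hx (Matrix.ext h)
    exact (norm_pos_iff.2 hpq).trans_le (norm_apply_le_projNorm x p q)
  rw [← div_le_iff₀ hpos]
  exact le_csSup hbdd ⟨x, hx, rfl⟩

end Norms

section Unitality

variable {n : ℕ} {φ : Mat n →ₗ[ℂ] Mat n}

theorem IsBlockPositive.map_one_le (hφ : IsBlockPositive (choiMatrix φ)) :
    φ 1 ≤ (alphaNorm (choiMatrix φ) : ℂ) • 1 := by
  refine Matrix.le_iff.2 (posSemidef_of_dotProduct_mulVec_nonneg fun y => ?_)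
  set α := alphaNorm (choiMatrix φ)
  have hφy : 0 ≤ star y ⬝ᵥ (φ 1 *ᵥ y) :=
    (nonneg_iff_posSemidef.1 (hφ.map_nonneg zero_le_one)).dotProduct_mulVec_nonneg y
  have hy : ((star y ⬝ᵥ y).re : ℂ) = star y ⬝ᵥ y :=
    (Complex.eq_re_of_ofReal_le (dotProduct_star_self_nonneg y)).symm
  have hnorm : ‖star y ⬝ᵥ (φ 1 *ᵥ y)‖ ≤ α * (star y ⬝ᵥ y).re := by
    calc ‖star y ⬝ᵥ (φ 1 *ᵥ y)‖
        = ‖trace (choiMatrix φ * (1 ⊗ₖ vecMulVec y (star y)))‖ := by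
          rw [trace_choiMatrix_mul_kronecker, transpose_one, trace_mul_vecMulVec]
      _ ≤ α * (‖(1 : Mat n)‖ * traceNorm (vecMulVec y (star y))) :=
          (norm_trace_mul_le _ _).trans
            (mul_le_mul_of_nonneg_left (projNorm_kronecker_le _ _) (alphaNorm_nonneg _))
      _ ≤ α * traceNorm (vecMulVec y (star y)) :=
          mul_le_mul_of_nonneg_left
            (mul_le_of_le_one_left (traceNorm_nonneg _) l2_opNorm_one_le) (alphaNorm_nonneg _)
      _ = α * (star y ⬝ᵥ y).re := by
          rw [traceNorm_of_nonneg (posSemidef_vecMulVec_self_star y).nonneg, trace_vecMulVec,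
            dotProduct_comm]
  rw [sub_mulVec, smul_mulVec, one_mulVec, dotProduct_sub, dotProduct_smul, smul_eq_mul, ← hy,
    Complex.eq_coe_norm_of_nonneg hφy, sub_nonneg]
  exact_mod_cast hnorm

theorem map_one_eq_one_of_choiMatrix_mem_setD (hφ : choiMatrix φ ∈ setD n) : φ 1 = 1 := by
  obtain ⟨-, hα, hpos, htr⟩ := hφ
  have hle : (1 - φ 1).PosSemidef := by simpa [hα, Matrix.le_iff] using hpos.map_one_le
  have htrace : trace (1 - φ 1) = 0 := by rw [trace_sub, ← trace_choiMatrix, htr]; simp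
  exact (sub_eq_zero.1 (hle.trace_eq_zero_iff.1 htrace)).symm

end Unitality

theorem choiMatrix_eq_conj_choiMatrix_transposition {n : ℕ} {φ : Mat n →ₗ[ℂ] Mat n} {V : Mat n}
    (hφ : ∀ x, φ x = V * xᵀ * Vᴴ) :
    choiMatrix φ = (1 ⊗ₖ V) * choiMatrix (transposition n) * (1 ⊗ₖ V)ᴴ := by
  rw [choiMatrix_transposition]
  simp only [choiMatrix, hφ, transpose_single, conjTranspose_kronecker, conjTranspose_one,
    Finset.mul_sum, Finset.sum_mul, ← mul_kronecker_mul, one_mul, mul_one]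

end BlockPositive

open BlockPositive Matrix in
theorem mainTheorem1_general {n : ℕ} {s : Mat₂ n} (hsq : s ^ 2 = 1) (hD : s ∈ setD n) :
    LocallyUnitarilyEquivalent s (choiMatrix (transposition n)) := by
  obtain ⟨φ, rfl⟩ := choiMatrix_surjective s
  let ψ : Mat n →ₚ[ℂ] Mat n := PositiveLinearMap.mk₀ φ fun _ => hD.2.2.1.map_nonneg
  have hunital : ψ 1 = 1 := map_one_eq_one_of_choiMatrix_mem_setD hD
  have hrow : ∀ i, ∑ j, ψ (single i j 1) * ψ (single j i 1) = 1 :=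
    sum_map_single_mul_map_single hsq
  obtain ⟨V, hV, hψ⟩ := exists_unitary_eq_conj_transpose hunital hrow
  exact ⟨1, one_mem _, V, hV, choiMatrix_eq_conj_choiMatrix_transposition hψ⟩

theorem mainTheorem1 (n : ℕ) (hn : n = 2 ∨ n = 3) (s : BlockPositive.Mat₂ n)
    (hsym : BlockPositive.IsSymmetry s) (hD : s ∈ BlockPositive.setD n) :
    BlockPositive.LocallyUnitarilyEquivalent s
      (BlockPositive.choiMatrix (BlockPositive.transposition n)) :=
  mainTheorem1_general hsym.2 hD
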